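/- For a matrix $B\in\mathbb{R}^{m\times d}$ with rows $B_{i,*}$, let $\tau_i(B)=B_{i,*}(B^{T}B)^{\dagger}(B_{i,*})^{T}$ be the leverage score of row $i$, where $\dagger$ is the Moore--Penrose pseudoinverse. For $p\ge 1$, the $\ell_p$ Lewis weights of $B$ are the weights $u\in\mathbb{R}^m$ with $u_i=\tau_i(U^{1/2-1/p}B)$ for all $i$, where $U=\mathrm{diag}(u)$, and $u_i>0$ for every nonzero row (zero rows have weight $0$). For $y\in\mathbb{R}^n$ and $\tau\ge 0$ let $H_y=\{i: |y_i|>\tau\}$ and $L_y=\{i:|y_i|\le\tau\}$, let $y_{L_y}$ be the restriction of $y$ to the coordinates in $L_y$, and let $\mathrm{colspan}(A)$ be the column space of $A$. Given $A\in\mathbb{R}^{n\times d}$, $p\ge1$ and $\alpha\ge 0$, consider the following algorithm. Start with $J=\emptyset$. Repeat $\alpha$ times ($\lfloor\alpha\rfloor$ times if $\alpha$ is not an integer): let $\{u_i\}_{i\in[n]\setminus J}$ be the $\ell_p$ Lewis weights of the submatrix $A_{[n]\setminus J,*}$ formed by the rows with index outside $J$, and add to $J$ all $i\in[n]\setminus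 J$ with $d^{\max\{0,p/2-1\}}u_i\ge \frac{1}{2\alpha}$. Return $J$. **Theorem.** There is an absolute constant $C>0$ such that for all $n,d$, all $A\in\mathbb{R}^{n\times d}$, all $\tau\ge0$, $p\ge1$ and $\alpha\ge 0$, the following holds. The algorithm can be carried out (the Lewis weights it needs exist), and every set $J\subseteq[n]$ that it returns satisfies $|J|\le C\,d^{\max\{p/2,1\}}\alpha^2$ and has the property that for every $y\in\mathrm{colspan}(A)$, if $\|y_{L_y}\|_p^p\le\alpha\,\tau^p$ and $|H_y|\le\alpha$, then $H_y\subseteq J$. In particular, there exists a set $J\subseteq[n]$ with $|J|\le C\,d^{\max\{p/2,1\}}\alpha^2$ and this property. -/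

import Mathlib

open Matrix

noncomputable section

namespace HeavyCoords

/-- The four Penrose conditions: `X` is the Moore-Penrose pseudoinverse of the real matrix `M`. -/
structure IsMoorePenrose {m n : Type*} [Fintype m] [Fintype n]
    (M : Matrix m n ℝ) (X : Matrix n m ℝ) : Prop where
  mul_mul_left : M * X * M = M
  mul_mul_right : X * M * X = X
  symm_left : (M * X)ᵀ = M * X
  symm_right : (X * M)ᵀ = X * M

/-- The pseudoinverse of a real symmetric matrix `S`: every eigenvalue `x` of `S` is replaced
by `x⁻¹`, where `0⁻¹ = 0`. See `isMoorePenrose_symmPinv`. -/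
def symmPinv {n : Type*} [Fintype n] [DecidableEq n] (S : Matrix n n ℝ) : Matrix n n ℝ :=
  cfc (fun x : ℝ => x⁻¹) S

theorem isMoorePenrose_symmPinv {n : Type*} [Fintype n] [DecidableEq n] (S : Matrix n n ℝ)
    (hS : Sᵀ = S) : IsMoorePenrose S (symmPinv S) := by
  have hsa : IsSelfAdjoint S := by
    rw [isSelfAdjoint_iff, star_eq_conjTranspose, conjTranspose_eq_transpose_of_trivial, hS]
  have hc : ∀ f : ℝ → ℝ, ContinuousOn f (spectrum ℝ S) := fun f =>
    (Matrix.finite_real_spectrum (A := S)).continuousOn f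
  have hid : cfc (fun x : ℝ => x) S = S := cfc_id' ℝ S hsa
  have hl : S * symmPinv S = cfc (fun x : ℝ => x * x⁻¹) S := by
    rw [cfc_mul (fun x : ℝ => x) (fun x : ℝ => x⁻¹) S (hc _) (hc _), hid]; rfl
  have hr : symmPinv S * S = cfc (fun x : ℝ => x⁻¹ * x) S := by
    rw [cfc_mul (fun x : ℝ => x⁻¹) (fun x : ℝ => x) S (hc _) (hc _), hid]; rfl
  have hsym : ∀ f : ℝ → ℝ, (cfc f S)ᵀ = cfc f S := fun f => by
    have h := cfc_predicate f S
    rw [isSelfAdjoint_iff, star_eq_conjTranspose, conjTranspose_eq_transpose_of_trivial] at h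
    exact h
  refine ⟨?_, ?_, ?_, ?_⟩
  · calc S * symmPinv S * S
        = cfc (fun x : ℝ => x * x⁻¹) S * cfc (fun x : ℝ => x) S := by rw [hl, hid]
      _ = cfc (fun x : ℝ => x * x⁻¹ * x) S := (cfc_mul _ _ S (hc _) (hc _)).symm
      _ = S := by simp only [mul_inv_mul_cancel, hid]
  · calc symmPinv S * S * symmPinv S
        = cfc (fun x : ℝ => x⁻¹ * x) S * cfc (fun x : ℝ => x⁻¹) S := by rw [hr]; rfl
      _ = cfc (fun x : ℝ => x⁻¹ * x * x⁻¹) S := (cfc_mul _ _ S (hc _) (hc _)).symm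
      _ = symmPinv S := by
        unfold symmPinv
        congr 1
        funext x
        by_cases hx : x = 0
        · simp [hx]
        · field_simp
  · rw [hl]; exact hsym _
  · rw [hr]; exact hsym _

/-- The leverage score `B_{i,*} (BᵀB)^† (B_{i,*})ᵀ` of the `i`-th row of `B`. -/
def leverageScore {ι : Type*} [Fintype ι] {d : ℕ} (B : Matrix ι (Fin d) ℝ) (i : ι) : ℝ :=
  B i ⬝ᵥ (symmPinv (Bᵀ * B) *ᵥ B i)

/-- `u` is the vector of `ℓ_p` Lewis weights of `A`: `u_i = τ_i(U^{1/2-1/p} A)` for all rows `i`,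
where `U = diag(u)`. The weight of a nonzero row is required to be positive, as always
understood (otherwise the negative powers of `U` make no sense for `p < 2`, and `u = 0` would be
a spurious solution). The weight of a zero row is `0` by the equation. -/
def IsLewisWeights {ι : Type*} [Fintype ι] [DecidableEq ι] {d : ℕ} (p : ℝ)
    (A : Matrix ι (Fin d) ℝ) (u : ι → ℝ) : Prop :=
  (∀ i, A i ≠ 0 → 0 < u i) ∧
    ∀ i, u i = leverageScore (Matrix.diagonal (fun j => u j ^ (1 / 2 - 1 / p : ℝ)) * A) i

/-- `A_{[n] ∖ J, *}`: the rows of `A` whose index is not in `J`. -/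
def remainingRows {n d : ℕ} (A : Matrix (Fin n) (Fin d) ℝ) (J : Finset (Fin n)) :
    Matrix {i : Fin n // i ∉ J} (Fin d) ℝ :=
  A.submatrix Subtype.val id

/-- One pass of the loop, leading from `J` to `J'`: with `u` the `ℓ_p` Lewis weights of
`A_{[n] ∖ J, *}`, every `i ∉ J` with `d^{max(0, p/2-1)} u_i ≥ 1/(2α)` is added to `J`. -/
def IsPass {n d : ℕ} (A : Matrix (Fin n) (Fin d) ℝ) (p α : ℝ) (J J' : Finset (Fin n)) : Prop :=
  ∃ u : {i : Fin n // i ∉ J} → ℝ, IsLewisWeights p (remainingRows A J) u ∧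
    ∀ i, i ∈ J' ↔ i ∈ J ∨
      ∃ h : i ∉ J, 1 / (2 * α) ≤ (d : ℝ) ^ max 0 (p / 2 - 1) * u ⟨i, h⟩

/-- `J` is the current set after `k` passes of the loop, started with the empty set. -/
inductive IsAfterPasses {n d : ℕ} (A : Matrix (Fin n) (Fin d) ℝ) (p α : ℝ) :
    ℕ → Finset (Fin n) → Prop
  | start : IsAfterPasses A p α 0 ∅
  | pass (k : ℕ) (J J' : Finset (Fin n)) :
      IsAfterPasses A p α k J → IsPass A p α J J' → IsAfterPasses A p α (k + 1) J'

/-- `J` is returned by the iterative Lewis-weight thresholding algorithm with parameter `α`: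
the loop is repeated `α` times (`⌊α⌋` times if `α` is not an integer). -/
def IsOutput {n d : ℕ} (A : Matrix (Fin n) (Fin d) ℝ) (p α : ℝ) (J : Finset (Fin n)) : Prop :=
  IsAfterPasses A p α ⌊α⌋₊ J

/-- The column space of `A`. -/
def colspan {n d : ℕ} (A : Matrix (Fin n) (Fin d) ℝ) : Submodule ℝ (Fin n → ℝ) :=
  Submodule.span ℝ (Set.range fun j : Fin d => fun i : Fin n => A i j)

/-- `H_y = {i | |y_i| > τ}`. -/
def heavy {n : ℕ} (τ : ℝ) (y : Fin n → ℝ) : Finset (Fin n) :=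
  Finset.univ.filter fun i => τ < |y i|

/-- `L_y = {i | |y_i| ≤ τ}`. -/
def light {n : ℕ} (τ : ℝ) (y : Fin n → ℝ) : Finset (Fin n) :=
  Finset.univ.filter fun i => |y i| ≤ τ

/-- Every `y` in the column space of `A` with `‖y_{L_y}‖_p^p ≤ α τ^p` and `|H_y| ≤ α`
has `H_y ⊆ J`. -/
def ContainsHeavy {n d : ℕ} (A : Matrix (Fin n) (Fin d) ℝ) (τ p α : ℝ)
    (J : Finset (Fin n)) : Prop :=
  ∀ y ∈ colspan A, ∑ i ∈ light τ y, |y i| ^ p ≤ α * τ ^ p →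
    ((heavy τ y).card : ℝ) ≤ α → heavy τ y ⊆ J

end HeavyCoords

end

/-!
The proof has three ingredients.

*Existence of Lewis weights.* Suppose first that `A` has full column rank, with rows `a_i`. The
matrices `Q` with `∑ i, ‖Q a_i‖ ^ p ≤ d` form a compact set, so `|det Q|` attains its maximum
there (`exists_det_maximizer`). The first-order condition, tested on the rank-one perturbations
`Q (1 + t x yᵀ)`, says that `M = QᵀQ` is the inverse of `∑ i, (a_iᵀ M a_i) ^ (p/2 - 1) a_i a_iᵀ`
(`exists_lewis_change_of_density`). With `u_i = (a_iᵀ M a_i) ^ (p/2)` the coefficients of this sum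
are `u_i ^ (1 - 2/p)`, so the inverse Gram matrix of `U^(1/2 - 1/p) A` is `M`, and the `i`-th
leverage score is `u_i ^ (1 - 2/p) u_i ^ (2/p) = u_i`. The argument works for every `p > 0`. A
general `A` is reduced to this case by a full-rank factorization `A = A' R`; the pseudoinverse is
never computed, because leverage scores can be read off from any generalized inverse of the Gram
matrix (`leverageScore_eq_of_ginv`).

*Sensitivity.* Leverage scores are the diagonal of an orthogonal projection, so they sum to at
most `d` and bound the share of the squared `ℓ_2` norm that a vector of the column space can put
on one coordinate. Applied to `U^(1/2 - 1/p) A` this gives, after passing from the quadratic form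
`∑ j, u_j ^ (1 - 2/p) (A x)_j ^ 2` to the `ℓ_p` norm, the bound
`|(A x)_i| ^ p ≤ d ^ max 0 (p/2 - 1) * u_i * ‖A x‖_p ^ p` (`IsLewisWeights.sensitivity_le`).

*The algorithm.* Weights summing to at most `d` allow at most `2 α d ^ max (p/2) 1` new indices in
a pass, and there are at most `α` passes. As long as some heavy coordinate of `y` is missing from
`J`, the largest missing one holds a `1 / (2α)` share of the `ℓ_p` mass outside `J`, hence is
caught by the next pass (`IsPass.exists_mem_heavy`). Since `y` has at most `⌊α⌋` heavy
coordinates, `⌊α⌋` passes catch all of them.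
-/

namespace HeavyCoords

variable {ι κ : Type*} [Fintype ι] [Fintype κ] {d : ℕ}

/-! ### Leverage scores -/

theorem transpose_symmPinv [DecidableEq κ] (S : Matrix κ κ ℝ) : (symmPinv S)ᵀ = symmPinv S := by
  have h : IsSelfAdjoint (symmPinv S) := cfc_predicate _ S
  rwa [isSelfAdjoint_iff, star_eq_conjTranspose, conjTranspose_eq_transpose_of_trivial] at h

theorem mul_eq_zero_of_transpose_mul_self_mul_eq_zero {l : Type*} (B : Matrix ι κ ℝ)
    (Z : Matrix κ l ℝ) (h : Bᵀ * B * Z = 0) : B * Z = 0 := by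
  rw [← conjTranspose_eq_transpose_of_trivial] at h
  exact (conjTranspose_mul_self_mul_eq_zero B Z).1 h

theorem mul_mul_transpose_mul_self_of_ginv [DecidableEq κ] (B : Matrix ι κ ℝ) (X : Matrix κ κ ℝ)
    (h : Bᵀ * B * X * (Bᵀ * B) = Bᵀ * B) : B * X * (Bᵀ * B) = B := by
  have h0 : B * (X * (Bᵀ * B) - 1) = 0 := by
    apply mul_eq_zero_of_transpose_mul_self_mul_eq_zero
    rw [Matrix.mul_sub, ← Matrix.mul_assoc, h, Matrix.mul_one, sub_self]
  rw [Matrix.mul_sub, ← Matrix.mul_assoc, Matrix.mul_one] at h0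
  exact sub_eq_zero.1 h0

/-- The matrix `B X Bᵀ`, for `X` a generalized inverse of `BᵀB`, does not depend on `X`: it is
the orthogonal projection onto the column space of `B`. -/
theorem mul_mul_transpose_eq_of_ginv [DecidableEq κ] (B : Matrix ι κ ℝ) (X Y : Matrix κ κ ℝ)
    (hX : Bᵀ * B * X * (Bᵀ * B) = Bᵀ * B) (hY : Bᵀ * B * Y * (Bᵀ * B) = Bᵀ * B) :
    B * X * Bᵀ = B * Y * Bᵀ := by
  have h : B * (X - Y) * (Bᵀ * B) = 0 := by
    rw [Matrix.mul_sub, Matrix.sub_mul, mul_mul_transpose_mul_self_of_ginv B X hX,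
      mul_mul_transpose_mul_self_of_ginv B Y hY, sub_self]
  have h2 : B * ((X - Y)ᵀ * Bᵀ) = 0 := by
    apply mul_eq_zero_of_transpose_mul_self_mul_eq_zero
    have := congrArg transpose h
    simpa [Matrix.transpose_mul, Matrix.mul_assoc] using this
  have h3 : B * (X - Y) * Bᵀ = 0 := by
    have := congrArg transpose h2
    simpa [Matrix.transpose_mul, Matrix.mul_assoc] using this
  rw [Matrix.mul_sub, Matrix.sub_mul] at h3
  exact sub_eq_zero.1 h3

theorem mul_mul_transpose_apply_self {l : Type*} (B : Matrix l κ ℝ) (X : Matrix κ κ ℝ) (i : l) :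
    (B * X * Bᵀ) i i = B i ⬝ᵥ (X *ᵥ B i) := by
  rw [dotProduct_mulVec]
  rfl

theorem isMoorePenrose_gram [DecidableEq κ] (B : Matrix ι κ ℝ) :
    IsMoorePenrose (Bᵀ * B) (symmPinv (Bᵀ * B)) :=
  isMoorePenrose_symmPinv _ (by rw [transpose_mul, transpose_transpose])

/-- The orthogonal projection onto the column space of `B`. -/
noncomputable def colProj [DecidableEq κ] (B : Matrix ι κ ℝ) : Matrix ι ι ℝ :=
  B * symmPinv (Bᵀ * B) * Bᵀ

theorem colProj_mul_self [DecidableEq κ] (B : Matrix ι κ ℝ) : colProj B * B = B := by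
  rw [colProj, Matrix.mul_assoc]
  exact mul_mul_transpose_mul_self_of_ginv B _ (isMoorePenrose_gram B).mul_mul_left

theorem transpose_colProj [DecidableEq κ] (B : Matrix ι κ ℝ) : (colProj B)ᵀ = colProj B := by
  rw [colProj, transpose_mul, transpose_mul, transpose_transpose, transpose_symmPinv,
    Matrix.mul_assoc]

theorem colProj_mul_colProj [DecidableEq κ] (B : Matrix ι κ ℝ) :
    colProj B * colProj B = colProj B := by
  conv_lhs => rw [colProj.eq_def B, ← Matrix.mul_assoc, ← Matrix.mul_assoc, ← colProj.eq_def B,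
    colProj_mul_self]
  rfl

theorem leverageScore_eq_colProj (B : Matrix ι (Fin d) ℝ) (i : ι) :
    leverageScore B i = colProj B i i :=
  (mul_mul_transpose_apply_self B _ i).symm

/-- Any generalized inverse of the Gram matrix computes the leverage scores. -/
theorem leverageScore_eq_of_ginv (B : Matrix ι (Fin d) ℝ) (X : Matrix (Fin d) (Fin d) ℝ)
    (hX : Bᵀ * B * X * (Bᵀ * B) = Bᵀ * B) (i : ι) :
    leverageScore B i = B i ⬝ᵥ (X *ᵥ B i) := by
  rw [leverageScore_eq_colProj, colProj, ← mul_mul_transpose_apply_self,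
    mul_mul_transpose_eq_of_ginv B _ X (isMoorePenrose_gram B).mul_mul_left hX]

theorem sum_sq_row_eq_diag {P : Matrix ι ι ℝ} (hs : Pᵀ = P) (hi : P * P = P) (i : ι) :
    ∑ j, P i j ^ 2 = P i i := by
  conv_rhs => rw [← hi, Matrix.mul_apply]
  refine Finset.sum_congr rfl fun j _ => ?_
  rw [sq]
  congr 1
  exact congrFun (congrFun hs j) i |>.symm ▸ rfl

/-- The leverage scores are the diagonal of a projection of rank at most `d`. -/
theorem sum_leverageScore_le (B : Matrix ι (Fin d) ℝ) : ∑ i, leverageScore B i ≤ d := by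
  have hM := isMoorePenrose_gram B
  set X := symmPinv (Bᵀ * B) with hX
  set P := X * (Bᵀ * B) with hP
  have hi : P * P = P := by rw [hP, ← Matrix.mul_assoc, hM.mul_mul_right]
  have htr : ∑ i, leverageScore B i = ∑ k, P k k := by
    have h1 : ∑ i, leverageScore B i = trace (colProj B) :=
      Finset.sum_congr rfl fun i _ => leverageScore_eq_colProj B i
    rw [h1, colProj, Matrix.mul_assoc, trace_mul_comm, Matrix.mul_assoc]
    rfl
  rw [htr]
  have hle : ∀ k, P k k ≤ 1 := fun k => by
    have h1 := sum_sq_row_eq_diag hM.symm_right hi k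
    have h2 : P k k ^ 2 ≤ ∑ j, P k j ^ 2 :=
      Finset.single_le_sum (f := fun j => P k j ^ 2) (fun j _ => sq_nonneg _) (Finset.mem_univ k)
    nlinarith
  calc ∑ k, P k k ≤ ∑ _k : Fin d, (1 : ℝ) := Finset.sum_le_sum fun k _ => hle k
    _ = d := by simp

/-- The leverage score of a row bounds the share of the squared norm that a vector in the column
space can put on that coordinate. -/
theorem sq_mulVec_le_leverageScore_mul (B : Matrix ι (Fin d) ℝ) (x : Fin d → ℝ) (i : ι) :
    (B *ᵥ x) i ^ 2 ≤ leverageScore B i * ∑ j, (B *ᵥ x) j ^ 2 := by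
  have hz : (B *ᵥ x) i = ∑ j, colProj B i j * (B *ᵥ x) j := by
    conv_lhs => rw [← colProj_mul_self B, ← mulVec_mulVec]
    rfl
  rw [leverageScore_eq_colProj,
    ← sum_sq_row_eq_diag (transpose_colProj B) (colProj_mul_colProj B) i, hz]
  exact Finset.sum_mul_sq_le_sq_mul_sq _ _ _

theorem leverageScore_nonneg (B : Matrix ι (Fin d) ℝ) (i : ι) : 0 ≤ leverageScore B i := by
  rw [leverageScore_eq_colProj,
    ← sum_sq_row_eq_diag (transpose_colProj B) (colProj_mul_colProj B) i]
  exact Finset.sum_nonneg fun j _ => sq_nonneg _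

/-! ### Lewis weights bound the sensitivities -/

section Sensitivity

variable [DecidableEq ι] {p : ℝ} {A : Matrix ι (Fin d) ℝ} {u : ι → ℝ}

theorem IsLewisWeights.nonneg (h : IsLewisWeights p A u) (i : ι) : 0 ≤ u i := by
  rw [h.2 i]
  exact leverageScore_nonneg _ i

theorem IsLewisWeights.sum_le (h : IsLewisWeights p A u) : ∑ i, u i ≤ d := by
  rw [Finset.sum_congr rfl fun i _ => h.2 i]
  exact sum_leverageScore_le _

theorem IsLewisWeights.pos_of_mulVec_ne_zero (h : IsLewisWeights p A u) {x : Fin d → ℝ} {i : ι}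
    (hi : (A *ᵥ x) i ≠ 0) : 0 < u i := by
  refine h.1 i fun h0 => hi ?_
  change A i ⬝ᵥ x = 0
  rw [h0, zero_dotProduct]

theorem rpow_half_sub_sq {a : ℝ} (ha : 0 ≤ a) (p : ℝ) :
    (a ^ (1 / 2 - 1 / p)) ^ 2 = a ^ (1 - 2 / p) := by
  rw [← Real.rpow_mul_natCast ha]
  congr 1
  push_cast
  ring

/-- The leverage score bound for `U^(1/2 - 1/p) A`, with the powers of `u_i` collected on the
right-hand side. -/
theorem IsLewisWeights.sq_le (h : IsLewisWeights p A u) (x : Fin d → ℝ) (i : ι) :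
    (A *ᵥ x) i ^ 2 ≤ u i ^ (2 / p) * ∑ j, u j ^ (1 - 2 / p) * (A *ᵥ x) j ^ 2 := by
  have key := sq_mulVec_le_leverageScore_mul (diagonal (fun j => u j ^ (1 / 2 - 1 / p)) * A) x i
  rw [← h.2 i] at key
  simp only [← mulVec_mulVec, mulVec_diagonal, mul_pow, rpow_half_sub_sq (h.nonneg _)] at key
  set S := ∑ j, u j ^ (1 - 2 / p) * (A *ᵥ x) j ^ 2
  by_cases hz : (A *ᵥ x) i = 0
  · rw [hz]
    have : 0 ≤ S := Finset.sum_nonneg fun j _ =>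
      mul_nonneg (Real.rpow_nonneg (h.nonneg j) _) (sq_nonneg _)
    have := mul_nonneg (Real.rpow_nonneg (h.nonneg i) (2 / p)) this
    simpa using this
  · have hu := h.pos_of_mulVec_ne_zero hz
    rw [Real.rpow_sub hu, Real.rpow_one, div_mul_eq_mul_div,
      div_le_iff₀ (Real.rpow_pos_of_pos hu _), mul_right_comm, mul_assoc] at key
    exact le_of_mul_le_mul_left (by linarith) hu

/-- The `p/2`-th power of `IsLewisWeights.sq_le`. -/
theorem IsLewisWeights.rpow_le (h : IsLewisWeights p A u) (hp : 1 ≤ p) (x : Fin d → ℝ) (i : ι) :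
    |(A *ᵥ x) i| ^ p ≤ u i * (∑ j, u j ^ (1 - 2 / p) * (A *ᵥ x) j ^ 2) ^ (p / 2) := by
  have hp0 : 0 < p := by linarith
  have hS : 0 ≤ ∑ j, u j ^ (1 - 2 / p) * (A *ᵥ x) j ^ 2 := Finset.sum_nonneg fun j _ =>
      mul_nonneg (Real.rpow_nonneg (h.nonneg j) _) (sq_nonneg _)
  have h1 := Real.rpow_le_rpow (sq_nonneg _) (h.sq_le x i) (by positivity : 0 ≤ p / 2)
  rw [Real.mul_rpow (Real.rpow_nonneg (h.nonneg i) _) hS, ← Real.rpow_mul (h.nonneg i),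
    show 2 / p * (p / 2) = 1 by field_simp, Real.rpow_one, ← sq_abs,
    ← Real.rpow_natCast_mul (abs_nonneg _)] at h1
  convert h1 using 2
  push_cast
  ring

/-- For `p ≥ 2` this is Hölder's inequality with the weights `u`, whose sum is at most `d`; for
`p < 2` it is obtained by inserting the pointwise bound `IsLewisWeights.sq_le` into the
quadratic form itself. -/
theorem IsLewisWeights.quadForm_rpow_le (h : IsLewisWeights p A u) (hp : 1 ≤ p)
    (x : Fin d → ℝ) :
    (∑ j, u j ^ (1 - 2 / p) * (A *ᵥ x) j ^ 2) ^ (p / 2) ≤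
      (d : ℝ) ^ max 0 (p / 2 - 1) * ∑ j, |(A *ᵥ x) j| ^ p := by
  have hp0 : 0 < p := by linarith
  set S := ∑ j, u j ^ (1 - 2 / p) * (A *ᵥ x) j ^ 2 with hSdef
  set N := ∑ j, |(A *ᵥ x) j| ^ p with hN
  have hS : 0 ≤ S := Finset.sum_nonneg fun j _ =>
      mul_nonneg (Real.rpow_nonneg (h.nonneg j) _) (sq_nonneg _)
  have hN0 : 0 ≤ N := Finset.sum_nonneg fun j _ => Real.rpow_nonneg (abs_nonneg _) _
  have hu0 : 0 ≤ ∑ i, u i := Finset.sum_nonneg fun i _ => h.nonneg i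
  rcases le_total 2 p with h2 | h2
  -- For `p ≥ 2`, Hölder with weights `u_j` and values `u_j ^ (-2/p) z_j ^ 2`, where `z = A x`.
  · have H := Real.inner_le_weight_mul_Lp_of_nonneg Finset.univ (p := p / 2) (by linarith) u
      (fun j => u j ^ (-(2 / p)) * (A *ᵥ x) j ^ 2) h.nonneg
      (fun j => mul_nonneg (Real.rpow_nonneg (h.nonneg j) _) (sq_nonneg _))
    have e1 : ∑ j, u j * (u j ^ (-(2 / p)) * (A *ᵥ x) j ^ 2) = S := by
      refine Finset.sum_congr rfl fun j _ => ?_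
      by_cases hz : (A *ᵥ x) j = 0
      · simp [hz]
      · have hu := h.pos_of_mulVec_ne_zero hz
        rw [sub_eq_add_neg, Real.rpow_add hu, Real.rpow_one, mul_assoc]
    have e2 : ∑ j, u j * (u j ^ (-(2 / p)) * (A *ᵥ x) j ^ 2) ^ (p / 2) = N := by
      refine Finset.sum_congr rfl fun j _ => ?_
      by_cases hz : (A *ᵥ x) j = 0
      · simp [hz, Real.zero_rpow hp0.ne', Real.zero_rpow (by positivity : p / 2 ≠ 0)]
      · have hu := h.pos_of_mulVec_ne_zero hz
        rw [Real.mul_rpow (Real.rpow_nonneg hu.le _) (sq_nonneg _), ← Real.rpow_mul hu.le,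
          show -(2 / p) * (p / 2) = -1 by field_simp, Real.rpow_neg_one,
          mul_inv_cancel_left₀ hu.ne', ← sq_abs, ← Real.rpow_natCast_mul (abs_nonneg _)]
        congr 1
        push_cast
        ring
    rw [e1, e2] at H
    have H2 := Real.rpow_le_rpow hS H (by positivity : 0 ≤ p / 2)
    rw [Real.mul_rpow (Real.rpow_nonneg hu0 _) (Real.rpow_nonneg hN0 _), ← Real.rpow_mul hu0,
      ← Real.rpow_mul hN0, inv_mul_cancel₀ (by positivity), Real.rpow_one,
      show (1 - (p / 2)⁻¹) * (p / 2) = p / 2 - 1 by field_simp] at H2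
    rw [max_eq_right (by linarith)]
    exact H2.trans (mul_le_mul_of_nonneg_right
      (Real.rpow_le_rpow hu0 h.sum_le (by linarith)) hN0)
  · rw [max_eq_left (by linarith), Real.rpow_zero, one_mul]
    rcases hS.eq_or_lt with h0 | h0
    · rw [← h0, Real.zero_rpow (by positivity)]
      exact hN0
    have H : S ≤ N * S ^ ((2 - p) / 2) := by
      rw [hN, Finset.sum_mul]
      conv_lhs => rw [hSdef]
      refine Finset.sum_le_sum fun j _ => ?_
      by_cases hz : (A *ᵥ x) j = 0
      · simp [hz, Real.zero_rpow hp0.ne']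
      have hu := h.pos_of_mulVec_ne_zero hz
      have hz' := abs_pos.2 hz
      -- `|z_j|² = |z_j|^p · (|z_j|²)^((2-p)/2)`, and the last factor is at most
      -- `(u_j^(2/p) S)^((2-p)/2) = u_j^(2/p-1) S^((2-p)/2)`.
      have hj := Real.rpow_le_rpow (sq_nonneg _) (h.sq_le x j)
        (by linarith : 0 ≤ (2 - p) / 2)
      rw [Real.mul_rpow (Real.rpow_nonneg hu.le _) hS, ← Real.rpow_mul hu.le,
        show 2 / p * ((2 - p) / 2) = -(1 - 2 / p) by field_simp; ring, ← sq_abs] at hj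
      have hsplit : (A *ᵥ x) j ^ 2 = |(A *ᵥ x) j| ^ p * (|(A *ᵥ x) j| ^ 2) ^ ((2 - p) / 2) := by
        rw [← Real.rpow_natCast_mul hz'.le, ← Real.rpow_add hz', ← sq_abs, ← Real.rpow_natCast]
        congr 1
        push_cast
        ring
      calc u j ^ (1 - 2 / p) * (A *ᵥ x) j ^ 2
          = u j ^ (1 - 2 / p) * (|(A *ᵥ x) j| ^ p * (|(A *ᵥ x) j| ^ 2) ^ ((2 - p) / 2)) := by
            rw [← hsplit]
        _ ≤ u j ^ (1 - 2 / p) * (|(A *ᵥ x) j| ^ p *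
              (u j ^ (-(1 - 2 / p)) * S ^ ((2 - p) / 2))) := by gcongr
        _ = |(A *ᵥ x) j| ^ p * S ^ ((2 - p) / 2) := by
            rw [Real.rpow_neg hu.le]
            have := (Real.rpow_pos_of_pos hu (1 - 2 / p)).ne'
            field_simp
    have e : S = S ^ (p / 2) * S ^ ((2 - p) / 2) := by
      rw [← Real.rpow_add h0, show p / 2 + (2 - p) / 2 = 1 by ring, Real.rpow_one]
    rw [e] at H
    have hpos := Real.rpow_pos_of_pos h0 ((2 - p) / 2)
    refine le_of_mul_le_mul_right (H.trans_eq ?_) hpos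
    rw [← e]

/-- No vector `A x` has more than a `d ^ max 0 (p/2 - 1) * u_i` share of its `ℓ_p` mass on the
coordinate `i`. -/
theorem IsLewisWeights.sensitivity_le (h : IsLewisWeights p A u) (hp : 1 ≤ p)
    (x : Fin d → ℝ) (i : ι) :
    |(A *ᵥ x) i| ^ p ≤ (d : ℝ) ^ max 0 (p / 2 - 1) * u i * ∑ j, |(A *ᵥ x) j| ^ p := by
  refine (h.rpow_le hp x i).trans ?_
  rw [mul_comm _ (u i), mul_assoc]
  exact mul_le_mul_of_nonneg_left (h.quadForm_rpow_le hp x) (h.nonneg i)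

end Sensitivity

/-! ### Existence of Lewis weights -/

section Existence

theorem dotProduct_self_nonneg (v : κ → ℝ) : 0 ≤ v ⬝ᵥ v :=
  Finset.sum_nonneg fun _ _ => mul_self_nonneg _

/-- The sum `∑ i, ‖Q a_i‖ ^ p` over the rows `a_i` of `A`, with the Euclidean norm. -/
noncomputable def rowPowerSum (p : ℝ) (A : Matrix ι κ ℝ) (Q : Matrix κ κ ℝ) : ℝ :=
  ∑ i, ((Q *ᵥ A i) ⬝ᵥ (Q *ᵥ A i)) ^ (p / 2)

theorem rowPowerSum_nonneg (p : ℝ) (A : Matrix ι κ ℝ) (Q : Matrix κ κ ℝ) :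
    0 ≤ rowPowerSum p A Q :=
  Finset.sum_nonneg fun _ _ => Real.rpow_nonneg (dotProduct_self_nonneg _) _

theorem rowPowerSum_smul {p : ℝ} (A : Matrix ι κ ℝ) (Q : Matrix κ κ ℝ) {s : ℝ}
    (hs : 0 ≤ s) : rowPowerSum p A (s • Q) = s ^ p * rowPowerSum p A Q := by
  unfold rowPowerSum
  rw [Finset.mul_sum]
  refine Finset.sum_congr rfl fun i _ => ?_
  rw [smul_mulVec, smul_dotProduct, dotProduct_smul, smul_eq_mul, smul_eq_mul, ← mul_assoc,
    Real.mul_rpow (mul_nonneg hs hs) (dotProduct_self_nonneg _), ← sq,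
    ← Real.rpow_natCast_mul hs]
  congr 2
  push_cast
  ring

theorem continuous_rowPowerSum {p : ℝ} (hp : 0 < p) (A : Matrix ι κ ℝ) :
    Continuous (rowPowerSum p A) := by
  unfold rowPowerSum
  refine continuous_finsetSum _ fun i _ => Continuous.rpow_const ?_ fun _ => Or.inr (by positivity)
  have : Continuous fun Q : Matrix κ κ ℝ => Q *ᵥ A i :=
    Continuous.matrix_mulVec continuous_id continuous_const
  exact this.dotProduct this

theorem eq_mul_transpose_mul_transpose [DecidableEq κ] {A : Matrix ι κ ℝ} {L : Matrix κ ι ℝ}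
    (hL : L * A = 1) (Q : Matrix κ κ ℝ) : Q = Q * Aᵀ * Lᵀ := by
  rw [Matrix.mul_assoc, ← transpose_mul, hL, transpose_one, Matrix.mul_one]

theorem eq_zero_of_rowPowerSum_eq_zero [DecidableEq κ] {p : ℝ} (hp : 0 < p) {A : Matrix ι κ ℝ}
    {L : Matrix κ ι ℝ} (hL : L * A = 1) {Q : Matrix κ κ ℝ} (h : rowPowerSum p A Q = 0) :
    Q = 0 := by
  have h1 := (Finset.sum_eq_zero_iff_of_nonneg fun i _ =>
    Real.rpow_nonneg (dotProduct_self_nonneg (Q *ᵥ A i)) (p / 2)).1 h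
  have h2 : Q * Aᵀ = 0 := by
    ext k i
    have h3 := (Real.rpow_eq_zero (dotProduct_self_nonneg _) (by positivity)).1
      (h1 i (Finset.mem_univ i))
    exact congrFun (dotProduct_self_eq_zero.1 h3) k
  rw [eq_mul_transpose_mul_transpose hL Q, h2, Matrix.zero_mul]

/-- The constraint bounds the entries of `Q Aᵀ`, and `Q` is recovered from `Q Aᵀ` by the left
inverse of `A`. -/
theorem isCompact_rowPowerSum_le [DecidableEq κ] {p : ℝ} (hp : 0 < p) {A : Matrix ι κ ℝ}
    {L : Matrix κ ι ℝ} (hL : L * A = 1) (r : ℝ) :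
    IsCompact {Q : Matrix κ κ ℝ | rowPowerSum p A Q ≤ r} := by
  set b := √(r ^ (2 / p)) with hb
  have hbox : IsCompact (Set.pi Set.univ fun _ : κ => Set.pi Set.univ fun _ : ι =>
      Set.Icc (-b) b : Set (κ → ι → ℝ)) :=
    isCompact_univ_pi fun _ => isCompact_univ_pi fun _ => isCompact_Icc
  have hcont : Continuous fun P : Matrix κ ι ℝ => P * Lᵀ :=
    Continuous.matrix_mul continuous_id continuous_const
  refine (hbox.image hcont).of_isClosed_subset
    (isClosed_le (continuous_rowPowerSum hp A) continuous_const) fun Q hQ => ?_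
  refine ⟨Q * Aᵀ, fun k _ i _ => ?_, (eq_mul_transpose_mul_transpose hL Q).symm⟩
  have h0 := dotProduct_self_nonneg (Q *ᵥ A i)
  have h1 : ((Q *ᵥ A i) ⬝ᵥ (Q *ᵥ A i)) ^ (p / 2) ≤ r :=
    (Finset.single_le_sum (f := fun i => ((Q *ᵥ A i) ⬝ᵥ (Q *ᵥ A i)) ^ (p / 2))
      (fun _ _ => Real.rpow_nonneg (dotProduct_self_nonneg _) _) (Finset.mem_univ i)).trans hQ
  have h2 := Real.rpow_le_rpow (Real.rpow_nonneg h0 _) h1 (by positivity : 0 ≤ 2 / p)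
  rw [← Real.rpow_mul h0, show p / 2 * (2 / p) = 1 by field_simp, Real.rpow_one] at h2
  have h3 : (Q *ᵥ A i) k ^ 2 ≤ r ^ (2 / p) := by
    refine le_trans ?_ h2
    rw [sq]
    exact Finset.single_le_sum (f := fun k => (Q *ᵥ A i) k * (Q *ᵥ A i) k)
      (fun _ _ => mul_self_nonneg _) (Finset.mem_univ k)
  exact abs_le.1 (Real.abs_le_sqrt h3)

/-- A maximizer of `|det Q|` under the constraint `∑ i, ‖Q a_i‖ ^ p ≤ card κ`, described by the
scale-invariant form of maximality. -/
theorem exists_det_maximizer [DecidableEq κ] [Nonempty κ] {p : ℝ} (hp : 0 < p)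
    {A : Matrix ι κ ℝ} {L : Matrix κ ι ℝ} (hL : L * A = 1) :
    ∃ Q : Matrix κ κ ℝ, Q.det ≠ 0 ∧ rowPowerSum p A Q = Fintype.card κ ∧
      ∀ Q' : Matrix κ κ ℝ, |Q'.det| ≤
        |Q.det| * (rowPowerSum p A Q' / Fintype.card κ) ^ (Fintype.card κ / p : ℝ) := by
  set r := (Fintype.card κ : ℝ) with hr
  have hr0 : 0 < r := by rw [hr]; exact_mod_cast Fintype.card_pos
  have hne : {Q : Matrix κ κ ℝ | rowPowerSum p A Q ≤ r}.Nonempty := by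
    refine ⟨(0 : ℝ) • 0, ?_⟩
    rw [Set.mem_ofPred_eq, rowPowerSum_smul _ _ le_rfl, Real.zero_rpow hp.ne', zero_mul]
    exact hr0.le
  obtain ⟨Q, hQ, hmax⟩ := (isCompact_rowPowerSum_le hp hL r).exists_isMaxOn hne
    (f := fun Q => |Q.det|) (Continuous.matrix_det continuous_id).abs.continuousOn
  have key : ∀ Q' : Matrix κ κ ℝ, |Q'.det| ≤
      |Q.det| * (rowPowerSum p A Q' / r) ^ (r / p) := fun Q' => by
    rcases (rowPowerSum_nonneg p A Q').eq_or_lt with h0 | h0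
    · rw [eq_zero_of_rowPowerSum_eq_zero hp hL h0.symm, det_zero, abs_zero]
      have := rowPowerSum_nonneg p A 0
      positivity
    set N := rowPowerSum p A Q' with hN
    have hq : 0 < N / r := by positivity
    -- `s` rescales `Q'` to the boundary of the constraint set.
    set s := (N / r) ^ (-(1 / p)) with hs
    have hs0 : 0 < s := Real.rpow_pos_of_pos hq _
    have hfeas : rowPowerSum p A (s • Q') ≤ r := by
      rw [rowPowerSum_smul _ _ hs0.le, ← hN, hs, ← Real.rpow_mul hq.le,
        show -(1 / p) * p = -1 by field_simp, Real.rpow_neg_one]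
      apply le_of_eq
      field_simp
    have h1 : |(s • Q').det| ≤ |Q.det| := hmax hfeas
    have e : s ^ Fintype.card κ = ((N / r) ^ (r / p))⁻¹ := by
      rw [hs, ← Real.rpow_mul_natCast hq.le, ← Real.rpow_neg hq.le, ← hr]
      congr 1
      ring
    rw [det_smul, abs_mul, abs_of_pos (pow_pos hs0 _), e,
      inv_mul_le_iff₀ (Real.rpow_pos_of_pos hq _), mul_comm] at h1
    exact h1
  have hdet : Q.det ≠ 0 := fun h => by
    have := key 1
    rw [h, det_one, abs_one, abs_zero, zero_mul] at this
    linarith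
  -- The bound `key` at `Q` itself shows that the constraint is tight.
  refine ⟨Q, hdet, le_antisymm hQ ?_, key⟩
  have h1 : 1 ≤ (rowPowerSum p A Q / r) ^ (r / p) :=
    le_of_mul_le_mul_left (by simpa using key Q) (abs_pos.2 hdet)
  by_contra! hlt
  have h2 := Real.rpow_lt_one (z := r / p) (by have := rowPowerSum_nonneg p A Q; positivity)
    ((div_lt_one hr0).2 hlt) (by positivity)
  linarith

/-- A degenerate base `q = 0` is allowed if the quadratic then vanishes identically; this covers
the zero rows of `A`. -/
theorem hasDerivAt_quadratic_rpow {q b e s : ℝ} (h : q = 0 → b = 0 ∧ e = 0) :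
    HasDerivAt (fun t : ℝ => (q + t * b + t ^ 2 * e) ^ s) (b * s * q ^ (s - 1)) 0 := by
  by_cases hq : q = 0
  · obtain ⟨rfl, rfl⟩ := h hq
    simpa using hasDerivAt_const (0 : ℝ) (q ^ s)
  · have h1 : HasDerivAt (fun t : ℝ => q + t * b + t ^ 2 * e) b 0 := by
      have := (((hasDerivAt_id' (0 : ℝ)).mul_const b).const_add q).fun_add
        (((hasDerivAt_id' (0 : ℝ)).fun_pow 2).mul_const e)
      simpa using this
    have := h1.rpow_const (p := s) (Or.inl (by simpa using hq))
    simpa using this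

/-- The first-order condition at a maximizer of `|det Q|`, in the direction of the rank-one
perturbation `Q (1 + t x yᵀ)`. -/
theorem dotProduct_eq_of_det_maximizer [DecidableEq κ] [Nonempty κ] {p : ℝ} (hp : 0 < p)
    {A : Matrix ι κ ℝ} {Q : Matrix κ κ ℝ} (hdet : Q.det ≠ 0)
    (hQ : rowPowerSum p A Q = Fintype.card κ)
    (hmax : ∀ Q' : Matrix κ κ ℝ, |Q'.det| ≤
        |Q.det| * (rowPowerSum p A Q' / Fintype.card κ) ^ (Fintype.card κ / p : ℝ))
    (x y : κ → ℝ) :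
    y ⬝ᵥ x = ∑ i, ((Q *ᵥ A i) ⬝ᵥ (Q *ᵥ A i)) ^ (p / 2 - 1) *
      ((y ⬝ᵥ A i) * ((Q *ᵥ A i) ⬝ᵥ (Q *ᵥ x))) := by
  set r := (Fintype.card κ : ℝ) with hr
  have hr0 : 0 < r := by rw [hr]; exact_mod_cast Fintype.card_pos
  -- `‖Q (1 + t x yᵀ) a_i‖ ^ 2 = q i + t * b i + t ^ 2 * e i`.
  let q : ι → ℝ := fun i => (Q *ᵥ A i) ⬝ᵥ (Q *ᵥ A i)
  let b : ι → ℝ := fun i => 2 * ((y ⬝ᵥ A i) * ((Q *ᵥ A i) ⬝ᵥ (Q *ᵥ x)))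
  let e : ι → ℝ := fun i => (y ⬝ᵥ A i) ^ 2 * ((Q *ᵥ x) ⬝ᵥ (Q *ᵥ x))
  have hN : ∀ t : ℝ, rowPowerSum p A (Q * (1 + t • vecMulVec x y)) =
      ∑ i, (q i + t * b i + t ^ 2 * e i) ^ (p / 2) := fun t => by
    refine Finset.sum_congr rfl fun i _ => ?_
    have : (Q * (1 + t • vecMulVec x y)) *ᵥ A i = Q *ᵥ A i + (t * (y ⬝ᵥ A i)) • (Q *ᵥ x) := by
      rw [← mulVec_mulVec, add_mulVec, one_mulVec, smul_mulVec, vecMulVec_mulVec, mulVec_add,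
        mulVec_smul]
      congr 1
      simp [mulVec_smul, smul_smul]
    rw [this]
    congr 1
    simp only [add_dotProduct, dotProduct_add, smul_dotProduct, dotProduct_smul, smul_eq_mul,
      dotProduct_comm (Q *ᵥ x) (Q *ᵥ A i), q, b, e]
    ring
  have hD : HasDerivAt (fun t : ℝ => rowPowerSum p A (Q * (1 + t • vecMulVec x y)))
      (∑ i, b i * (p / 2) * q i ^ (p / 2 - 1)) 0 := by
    simp only [hN]
    refine HasDerivAt.fun_sum fun i _ => hasDerivAt_quadratic_rpow fun h0 => ?_
    have hA : A i = 0 := eq_zero_of_mulVec_eq_zero hdet (dotProduct_self_eq_zero.1 h0)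
    simp [b, e, hA]
  have hN0 : rowPowerSum p A (Q * (1 + (0 : ℝ) • vecMulVec x y)) = r := by
    rw [zero_smul, add_zero, Matrix.mul_one, hQ]
  have hF := (((hD.div_const r).rpow_const (p := r / p)
    (Or.inl (by rw [hN0, div_self hr0.ne']; exact one_ne_zero))).sub
    (((hasDerivAt_id (0 : ℝ)).mul_const (y ⬝ᵥ x)).const_add 1))
  have hmin : IsLocalMin ((fun t : ℝ =>
      (rowPowerSum p A (Q * (1 + t • vecMulVec x y)) / r) ^ (r / p)) -
      fun t : ℝ => 1 + id t * (y ⬝ᵥ x)) 0 := by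
    refine Filter.Eventually.of_forall fun t => ?_
    have h1 := hmax (Q * (1 + t • vecMulVec x y))
    have h2 : (1 + t • vecMulVec x y).det = 1 + t * (y ⬝ᵥ x) := by
      rw [← smul_vecMulVec, vecMulVec_eq Unit, det_one_add_replicateCol_mul_replicateRow, dotProduct_smul, smul_eq_mul]
    rw [det_mul, abs_mul, h2] at h1
    have h3 := le_of_mul_le_mul_left h1 (abs_pos.2 hdet)
    simp only [Pi.sub_apply, id]
    rw [hN0, div_self hr0.ne', Real.one_rpow]
    linarith [le_abs_self (1 + t * (y ⬝ᵥ x))]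
  have h0 := hmin.hasDerivAt_eq_zero hF
  rw [hN0, div_self hr0.ne', Real.one_rpow, mul_one, one_mul] at h0
  have h1 : ∑ i, b i * (p / 2) * q i ^ (p / 2 - 1) = p * ∑ i, q i ^ (p / 2 - 1) *
      ((y ⬝ᵥ A i) * ((Q *ᵥ A i) ⬝ᵥ (Q *ᵥ x))) := by
    rw [Finset.mul_sum]
    refine Finset.sum_congr rfl fun i _ => ?_
    simp only [b]
    ring
  rw [h1, div_mul_div_comm, mul_comm _ r, mul_div_mul_left _ _ hr0.ne',
    mul_div_cancel_left₀ _ hp.ne'] at h0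
  exact (sub_eq_zero.1 h0).symm

/-- Lewis's change of density for a matrix of full column rank: `M = QᵀQ` is the inverse of
`∑ i, (a_iᵀ M a_i) ^ (p/2 - 1) a_i a_iᵀ`. -/
theorem exists_lewis_change_of_density [DecidableEq ι] [DecidableEq κ] {p : ℝ} (hp : 0 < p)
    {A : Matrix ι κ ℝ} {L : Matrix κ ι ℝ} (hL : L * A = 1) :
    ∃ Q : Matrix κ κ ℝ, Q.det ≠ 0 ∧
      Aᵀ * diagonal (fun i => ((Q *ᵥ A i) ⬝ᵥ (Q *ᵥ A i)) ^ (p / 2 - 1)) * A * (Qᵀ * Q) = 1 := by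
  cases isEmpty_or_nonempty κ
  · exact ⟨1, by simp, Subsingleton.elim _ _⟩
  obtain ⟨Q, hdet, hQ, hmax⟩ := exists_det_maximizer hp hL
  refine ⟨Q, hdet, ?_⟩
  ext k j
  have h := dotProduct_eq_of_det_maximizer hp hdet hQ hmax (Pi.single j 1) (Pi.single k 1)
  have e1 : (1 : Matrix κ κ ℝ) k j = Pi.single k 1 ⬝ᵥ Pi.single j (1 : ℝ) := by
    rw [single_one_dotProduct, Matrix.one_apply, Pi.single_apply]
  rw [e1, h, Matrix.mul_assoc, Matrix.mul_apply]
  refine Finset.sum_congr rfl fun i _ => ?_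
  rw [mul_diagonal, transpose_apply, single_one_dotProduct]
  have : (A * (Qᵀ * Q)) i j = (Q *ᵥ A i) ⬝ᵥ (Q *ᵥ Pi.single j 1) := by
    rw [← Matrix.mul_assoc, Matrix.mul_apply, mulVec_single_one]
    refine Finset.sum_congr rfl fun l _ => ?_
    congr 1
    rw [Matrix.mul_apply]
    exact Finset.sum_congr rfl fun m _ => mul_comm _ _
  rw [this]
  ring

/-- A full-rank factorization `A = A' R`, with a left inverse `L` of `A'` and a right inverse `T`
of `R`. -/
theorem exists_full_rank_factorization (A : Matrix ι (Fin d) ℝ) [DecidableEq ι] :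
    ∃ (r : ℕ) (A' : Matrix ι (Fin r) ℝ) (R : Matrix (Fin r) (Fin d) ℝ)
      (L : Matrix (Fin r) ι ℝ) (T : Matrix (Fin d) (Fin r) ℝ),
      A = A' * R ∧ L * A' = 1 ∧ R * T = 1 := by
  let f := A.toLin'
  let V := LinearMap.range f
  let bV := Module.finBasis ℝ V
  let eV := bV.equivFun
  obtain ⟨g, hg⟩ := f.rangeRestrict.exists_rightInverse_of_surjective f.range_rangeRestrict
  obtain ⟨l, hl⟩ := V.subtype.exists_leftInverse_of_injective V.ker_subtype
  refine ⟨_, LinearMap.toMatrix' (V.subtype ∘ₗ eV.symm.toLinearMap),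
    LinearMap.toMatrix' (eV.toLinearMap ∘ₗ f.rangeRestrict),
    LinearMap.toMatrix' (eV.toLinearMap ∘ₗ l),
    LinearMap.toMatrix' (g ∘ₗ eV.symm.toLinearMap), ?_, ?_, ?_⟩
  · rw [← LinearMap.toMatrix'_comp]
    conv_lhs => rw [← LinearMap.toMatrix'_toLin' A]
    congr 1
    refine LinearMap.ext fun x => ?_
    simp [f]
  · rw [← LinearMap.toMatrix'_comp, ← LinearMap.toMatrix'_id]
    congr 1
    refine LinearMap.ext fun x => ?_
    have : l (eV.symm x) = eV.symm x := LinearMap.congr_fun hl (eV.symm x)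
    simp [this]
  · rw [← LinearMap.toMatrix'_comp, ← LinearMap.toMatrix'_id]
    congr 1
    refine LinearMap.ext fun x => ?_
    have : f.rangeRestrict (g (eV.symm x)) = eV.symm x := LinearMap.congr_fun hg (eV.symm x)
    simp [this]

/-- In terms of a full-rank factorization `A = A' R` with `R T = 1`, the Lewis quadratic form of `A`
is `T QᵀQ Tᵀ`, where `QᵀQ` is that of `A'`. -/
theorem exists_isLewisWeights [DecidableEq ι] {p : ℝ} (hp : 0 < p) (A : Matrix ι (Fin d) ℝ) :
    ∃ u : ι → ℝ, IsLewisWeights p A u := by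
  obtain ⟨r, A', R, L, T, hA, hL, hR⟩ := exists_full_rank_factorization A
  obtain ⟨Q, hdet, hQ⟩ := exists_lewis_change_of_density hp hL
  set q : ι → ℝ := fun i => (Q *ᵥ A' i) ⬝ᵥ (Q *ᵥ A' i) with hq
  have hq0 : ∀ i, 0 ≤ q i := fun i => dotProduct_self_nonneg _
  have hrow : ∀ i, A i = Rᵀ *ᵥ A' i := fun i => by
    rw [mulVec_transpose, hA]
    rfl
  have hpow : ∀ i, (q i ^ (p / 2)) ^ (1 - 2 / p) = q i ^ (p / 2 - 1) := fun i => by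
    rw [← Real.rpow_mul (hq0 i)]
    congr 1
    field_simp
  set B := diagonal (fun j => (q j ^ (p / 2)) ^ (1 / 2 - 1 / p)) * A with hB
  set X := T * (Qᵀ * Q) * Tᵀ with hX
  have hgram : Bᵀ * B = Rᵀ * (A'ᵀ * diagonal (fun i => q i ^ (p / 2 - 1)) * A') * R := by
    rw [hB, transpose_mul, diagonal_transpose, Matrix.mul_assoc, ← Matrix.mul_assoc (diagonal _),
      diagonal_mul_diagonal]
    simp only [← sq, rpow_half_sub_sq (Real.rpow_nonneg (hq0 _) _), hpow]
    rw [hA, transpose_mul]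
    simp only [Matrix.mul_assoc]
  have hginv : Bᵀ * B * X * (Bᵀ * B) = Bᵀ * B := by
    set G := A'ᵀ * diagonal (fun i => q i ^ (p / 2 - 1)) * A' with hG
    have hR' : Tᵀ * Rᵀ = 1 := by rw [← transpose_mul, hR, transpose_one]
    calc Bᵀ * B * X * (Bᵀ * B)
        = Rᵀ * (G * ((R * T) * (Qᵀ * Q)) * (Tᵀ * Rᵀ) * G) * R := by
          rw [hgram, hX]
          simp only [Matrix.mul_assoc]
      _ = Bᵀ * B := by
          rw [hR, hR', Matrix.one_mul, hQ, Matrix.one_mul, Matrix.one_mul, hgram]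
  have hquad : ∀ i, A i ⬝ᵥ (X *ᵥ A i) = q i := fun i => by
    have h1 : Tᵀ *ᵥ A i = A' i := by
      rw [hrow, mulVec_mulVec, ← transpose_mul, hR, transpose_one, one_mulVec]
    rw [hX, ← mulVec_mulVec, h1, ← mulVec_mulVec, dotProduct_mulVec, ← mulVec_transpose, h1,
      ← mulVec_mulVec, dotProduct_mulVec, ← mulVec_transpose, transpose_transpose]
  refine ⟨fun i => q i ^ (p / 2), fun i hi => ?_, fun i => ?_⟩
  · refine Real.rpow_pos_of_pos ((hq0 i).lt_of_ne fun h => hi ?_) _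
    rw [hrow, eq_zero_of_mulVec_eq_zero hdet (dotProduct_self_eq_zero.1 h.symm), mulVec_zero]
  · rw [leverageScore_eq_of_ginv B X hginv i]
    have hBi : B i = (q i ^ (p / 2)) ^ (1 / 2 - 1 / p) • A i := by
      ext k
      rw [hB, diagonal_mul]
      rfl
    rw [hBi, mulVec_smul, smul_dotProduct, dotProduct_smul, hquad, smul_eq_mul, smul_eq_mul,
      ← mul_assoc, ← sq, rpow_half_sub_sq (Real.rpow_nonneg (hq0 _) _), hpow]
    change q i ^ (p / 2) = _
    rcases (hq0 i).eq_or_lt with h | h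
    · rw [← h, mul_zero, Real.zero_rpow (by positivity)]
    · rw [Real.rpow_sub_one h.ne', div_mul_cancel₀ _ h.ne']

end Existence

/-! ### The thresholding algorithm -/

section Algorithm

variable {n d : ℕ} {A : Matrix (Fin n) (Fin d) ℝ} {p α : ℝ}

theorem exists_isAfterPasses (hp : 0 < p) (k : ℕ) :
    ∃ J : Finset (Fin n), IsAfterPasses A p α k J := by
  classical
  induction k with
  | zero => exact ⟨∅, .start⟩
  | succ k ih =>
    obtain ⟨J, hJ⟩ := ih
    obtain ⟨u, hu⟩ := exists_isLewisWeights hp (remainingRows A J)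
    exact ⟨Finset.univ.filter fun i => i ∈ J ∨
      ∃ h : i ∉ J, 1 / (2 * α) ≤ (d : ℝ) ^ max 0 (p / 2 - 1) * u ⟨i, h⟩,
      .pass k J _ hJ ⟨u, hu, fun i => by simp⟩⟩

theorem IsPass.subset {J J' : Finset (Fin n)} (h : IsPass A p α J J') : J ⊆ J' := by
  obtain ⟨u, -, hJ'⟩ := h
  exact fun i hi => (hJ' i).2 (Or.inl hi)

theorem rpow_max_mul_self (d : ℕ) (p : ℝ) :
    (d : ℝ) ^ max 0 (p / 2 - 1) * d = (d : ℝ) ^ max (p / 2) 1 := by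
  have h1 : max (p / 2) 1 = max 0 (p / 2 - 1) + 1 := by
    rw [max_comm, ← max_add_add_right]
    ring_nf
  rw [h1, Real.rpow_add_one' d.cast_nonneg (by positivity)]

/-- Lewis weights sum to at most `d`, so few of them reach the threshold. -/
theorem IsPass.card_le (hα : 0 < α) {J J' : Finset (Fin n)} (h : IsPass A p α J J') :
    (J'.card : ℝ) ≤ J.card + 2 * α * (d : ℝ) ^ max (p / 2) 1 := by
  have hsub := h.subset
  obtain ⟨u, hu, hJ'⟩ := h
  set D := (d : ℝ) ^ max 0 (p / 2 - 1) with hD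
  have hD0 : 0 ≤ D := by positivity
  have hu0 := hu.nonneg
  -- `v` extends the weights by `0` to the rows in `J`.
  let v : Fin n → ℝ := fun i => if hi : i ∉ J then u ⟨i, hi⟩ else 0
  have hv0 : ∀ i, 0 ≤ v i := fun i => by
    simp only [v]
    split_ifs
    exacts [le_rfl, hu0 _]
  have h1 : ∀ i ∈ J' \ J, 1 / (2 * α) ≤ D * v i := fun i hi => by
    obtain ⟨hi', hiJ⟩ := Finset.mem_sdiff.1 hi
    rcases (hJ' i).1 hi' with h | ⟨h, hle⟩
    · exact absurd h hiJ
    · simpa [v, hiJ] using hle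
  have h2 : ∑ i ∈ J' \ J, v i ≤ d := by
    refine le_trans ?_ hu.sum_le
    have h3 : ∑ i ∈ J' \ J, v i ≤ ∑ i ∈ Finset.univ.filter (· ∉ J), v i :=
      Finset.sum_le_sum_of_subset_of_nonneg
        (fun i hi => by simpa using (Finset.mem_sdiff.1 hi).2) fun i _ _ => hv0 i
    refine h3.trans_eq ?_
    rw [Finset.sum_subtype (p := fun i => i ∉ J) _ (by simp)]
    exact Finset.sum_congr rfl fun i _ => by simp [v, i.2]
  have h4 : ((J' \ J).card : ℝ) * (1 / (2 * α)) ≤ D * d := by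
    rw [← nsmul_eq_mul]
    refine (Finset.card_nsmul_le_sum _ _ _ h1).trans ?_
    rw [← Finset.mul_sum]
    exact mul_le_mul_of_nonneg_left h2 hD0
  rw [hD, rpow_max_mul_self, mul_one_div, div_le_iff₀ (by positivity)] at h4
  have h5 : (J'.card : ℝ) = J.card + (J' \ J).card := by
    rw [← Nat.cast_add, add_comm, Finset.card_sdiff_add_card_eq_card hsub]
  linarith

theorem IsAfterPasses.card_le (hα : 0 < α) {k : ℕ} {J : Finset (Fin n)}
    (h : IsAfterPasses A p α k J) :
    (J.card : ℝ) ≤ k * (2 * α * (d : ℝ) ^ max (p / 2) 1) := by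
  induction h with
  | start => simp
  | pass k J J' _ hpass ih =>
    have := hpass.card_le hα
    push_cast
    linarith

theorem exists_mulVec_eq_of_mem_colspan {y : Fin n → ℝ} (hy : y ∈ colspan A) :
    ∃ x, A *ᵥ x = y := by
  have : colspan A = LinearMap.range A.mulVecLin := (range_mulVecLin A).symm
  rw [this] at hy
  exact hy

/-- The largest remaining coordinate `i` is heavy, and it carries a `1 / (2α)` share of the
remaining `ℓ_p` mass: the light coordinates contribute at most `α τ ^ p ≤ α |y_i| ^ p`, and each
of the at most `α` heavy ones at most `|y_i| ^ p`. Hence its Lewis weight reaches the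
threshold. -/
theorem IsPass.exists_mem_heavy {τ : ℝ} (hτ : 0 ≤ τ) (hp : 1 ≤ p) (hα : 0 < α)
    {J J' : Finset (Fin n)} (h : IsPass A p α J J') (x : Fin d → ℝ)
    (hlight : ∑ i ∈ light τ (A *ᵥ x), |(A *ᵥ x) i| ^ p ≤ α * τ ^ p)
    (hheavy : ((heavy τ (A *ᵥ x)).card : ℝ) ≤ α) (hJ : ¬ heavy τ (A *ᵥ x) ⊆ J) :
    ∃ i ∈ heavy τ (A *ᵥ x), i ∉ J ∧ i ∈ J' := by
  obtain ⟨u, hu, hJ'⟩ := h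
  set y := A *ᵥ x with hy
  obtain ⟨i, hi, hmax⟩ := Finset.exists_max_image (heavy τ y \ J) (fun i => |y i|)
    (Finset.sdiff_nonempty.2 hJ)
  obtain ⟨hiH, hiJ⟩ := Finset.mem_sdiff.1 hi
  have hτi : τ < |y i| := (Finset.mem_filter.1 hiH).2
  have hpos : 0 < |y i| ^ p := Real.rpow_pos_of_pos (hτ.trans_lt hτi) p
  refine ⟨i, hiH, hiJ, (hJ' i).2 (Or.inr ⟨hiJ, ?_⟩)⟩
  have hs := hu.sensitivity_le hp x ⟨i, hiJ⟩
  have hrow : ∀ j : {j : Fin n // j ∉ J}, (remainingRows A J *ᵥ x) j = y j := fun j => rfl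
  simp only [hrow] at hs
  have hmass : ∑ j : {j : Fin n // j ∉ J}, |y j| ^ p ≤ 2 * α * |y i| ^ p := by
    have e : ∑ j : {j : Fin n // j ∉ J}, |y j| ^ p =
        ∑ j ∈ Finset.univ.filter (· ∉ J), |y j| ^ p :=
      (Finset.sum_subtype (p := fun j => j ∉ J) _ (by simp) fun j => |y j| ^ p).symm
    have hsub : Finset.univ.filter (· ∉ J) ⊆ light τ y ∪ (heavy τ y \ J) := fun j hj => by
      have hj' : j ∉ J := by simpa using hj
      rcases le_or_gt |y j| τ with hle | hgt
      · exact Finset.mem_union_left _ (by simpa [light] using hle)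
      · exact Finset.mem_union_right _ (by simpa [heavy, hj'] using hgt)
    have h0 : ∀ j, 0 ≤ |y j| ^ p := fun j => Real.rpow_nonneg (abs_nonneg _) _
    have hH : ∑ j ∈ heavy τ y \ J, |y j| ^ p ≤ α * |y i| ^ p := by
      refine (Finset.sum_le_card_nsmul _ _ (|y i| ^ p) fun j hj =>
        Real.rpow_le_rpow (abs_nonneg _) (hmax j hj) (by linarith)).trans ?_
      rw [nsmul_eq_mul]
      refine mul_le_mul_of_nonneg_right (le_trans ?_ hheavy) hpos.le
      exact_mod_cast Finset.card_le_card Finset.sdiff_subset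
    have hL : ∑ j ∈ light τ y, |y j| ^ p ≤ α * |y i| ^ p :=
      hlight.trans (mul_le_mul_of_nonneg_left
        (Real.rpow_le_rpow hτ hτi.le (by linarith)) hα.le)
    have hU := Finset.sum_union_inter (s₁ := light τ y) (s₂ := heavy τ y \ J)
      (f := fun j => |y j| ^ p)
    have hI : 0 ≤ ∑ j ∈ light τ y ∩ (heavy τ y \ J), |y j| ^ p :=
      Finset.sum_nonneg fun j _ => h0 j
    have := Finset.sum_le_sum_of_subset_of_nonneg hsub fun j _ _ => h0 j
    rw [e]
    linarith
  have hD0 : 0 ≤ (d : ℝ) ^ max 0 (p / 2 - 1) * u ⟨i, hiJ⟩ :=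
    mul_nonneg (by positivity) (hu.nonneg _)
  have h1 := hs.trans (mul_le_mul_of_nonneg_left hmass hD0)
  rw [div_le_iff₀ (by positivity)]
  exact le_of_mul_le_mul_right (by linarith) hpos

/-- Every pass catches a new heavy coordinate until all of them are caught. -/
theorem IsAfterPasses.heavy_subset_or_card_le {τ : ℝ} (hτ : 0 ≤ τ) (hp : 1 ≤ p) (hα : 0 < α)
    (x : Fin d → ℝ) (hlight : ∑ i ∈ light τ (A *ᵥ x), |(A *ᵥ x) i| ^ p ≤ α * τ ^ p)
    (hheavy : ((heavy τ (A *ᵥ x)).card : ℝ) ≤ α) {k : ℕ} {J : Finset (Fin n)}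
    (h : IsAfterPasses A p α k J) :
    heavy τ (A *ᵥ x) ⊆ J ∨ k ≤ (heavy τ (A *ᵥ x) ∩ J).card := by
  induction h with
  | start => exact Or.inr (Nat.zero_le _)
  | pass k J J' _ hpass ih =>
    by_cases hJ : heavy τ (A *ᵥ x) ⊆ J
    · exact Or.inl (hJ.trans hpass.subset)
    obtain ⟨i, hiH, hiJ, hiJ'⟩ := hpass.exists_mem_heavy hτ hp hα x hlight hheavy hJ
    refine Or.inr ((Nat.succ_le_succ (ih.resolve_left hJ)).trans (Finset.card_lt_card ?_))
    refine (Finset.ssubset_iff_of_subset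
      (Finset.inter_subset_inter_left hpass.subset)).2 ⟨i, ?_, ?_⟩
    · exact Finset.mem_inter.2 ⟨hiH, hiJ'⟩
    · exact fun h => hiJ (Finset.mem_inter.1 h).2

theorem IsOutput.containsHeavy {τ : ℝ} (hτ : 0 ≤ τ) (hp : 1 ≤ p)
    {J : Finset (Fin n)} (h : IsOutput A p α J) : ContainsHeavy A τ p α J := by
  intro y hy hlight hheavy
  obtain ⟨x, rfl⟩ := exists_mulVec_eq_of_mem_colspan hy
  have hfloor : (heavy τ (A *ᵥ x)).card ≤ ⌊α⌋₊ := Nat.le_floor hheavy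
  rcases Nat.eq_zero_or_pos (heavy τ (A *ᵥ x)).card with h0 | h0
  · rw [Finset.card_eq_zero.1 h0]
    exact Finset.empty_subset _
  have hα : 0 < α := lt_of_lt_of_le (by exact_mod_cast h0) hheavy
  rcases IsAfterPasses.heavy_subset_or_card_le hτ hp hα x hlight hheavy h with h1 | h1
  · exact h1
  · exact Finset.inter_eq_left.1
      (Finset.eq_of_subset_of_card_le Finset.inter_subset_left (hfloor.trans h1))

theorem IsOutput.card_le (hα : 0 ≤ α) {J : Finset (Fin n)} (h : IsOutput A p α J) :
    (J.card : ℝ) ≤ 2 * ((d : ℝ) ^ max (p / 2) 1 * α ^ 2) := by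
  rcases hα.eq_or_lt with rfl | hα
  · have hJ : J = ∅ := by
      unfold IsOutput at h
      rw [Nat.floor_zero] at h
      cases h
      rfl
    simp [hJ]
  · refine (IsAfterPasses.card_le hα h).trans ?_
    have hf : (⌊α⌋₊ : ℝ) ≤ α := Nat.floor_le hα.le
    have := mul_le_mul_of_nonneg_right hf
      (by positivity : 0 ≤ 2 * α * (d : ℝ) ^ max (p / 2) 1)
    nlinarith

end Algorithm

end HeavyCoords

theorem mainTheorem3 :
    ∃ C : ℝ, 0 < C ∧
      ∀ (n d : ℕ) (A : Matrix (Fin n) (Fin d) ℝ) (τ p α : ℝ), 0 ≤ τ → 1 ≤ p → 0 ≤ α →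
        (∃ J : Finset (Fin n), HeavyCoords.IsOutput A p α J) ∧
        (∀ J : Finset (Fin n), HeavyCoords.IsOutput A p α J →
          (J.card : ℝ) ≤ C * ((d : ℝ) ^ max (p / 2) 1 * α ^ 2) ∧
            HeavyCoords.ContainsHeavy A τ p α J) ∧
        (∃ J : Finset (Fin n),
          (J.card : ℝ) ≤ C * ((d : ℝ) ^ max (p / 2) 1 * α ^ 2) ∧
            HeavyCoords.ContainsHeavy A τ p α J) := by
  refine ⟨2, two_pos, fun n d A τ p α hτ hp hα => ?_⟩
  have hex : ∃ J : Finset (Fin n), HeavyCoords.IsOutput A p α J :=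
    HeavyCoords.exists_isAfterPasses (zero_lt_one.trans_le hp) _
  have hall : ∀ J : Finset (Fin n), HeavyCoords.IsOutput A p α J →
      (J.card : ℝ) ≤ 2 * ((d : ℝ) ^ max (p / 2) 1 * α ^ 2) ∧
        HeavyCoords.ContainsHeavy A τ p α J :=
    fun J hJ => ⟨hJ.card_le hα, hJ.containsHeavy hτ hp⟩
  exact ⟨hex, hall, hex.imp hall⟩
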